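/- Let $N\in\mathbb N$, let $(\Omega,\mathcal F,\mathbb P)$ be a probability space and let $(\tau_x)_{x\in\mathbb R^N}$ be an ergodic $N$-dimensional dynamical system on it. That is, $\tau_x:\Omega\to\Omega$ are measurable and measure preserving maps with $\tau_0=\mathrm{id}$ and $\tau_{x+y}=\tau_x\circ\tau_y$, the map $(x,\omega)\mapsto\tau_x\omega$ is measurable with respect to $\mathcal B(\mathbb R^N)\otimes\mathcal F$, and every $A\in\mathcal F$ with $\mathbb P(\tau_xA\,\Delta\,A)=0$ for all $x\in\mathbb R^N$ has probability $0$ or $1$. Let $v$ be a Lipschitz random function, that is, for some $\kappa>0$, a map $\omega\mapsto v(\cdot,\omega)$ from $\Omega$ into the space of $\kappa$-Lipschitz functions $\mathbb R^N\to\mathbb R$ which is measurable with respect to the Borel $\sigma$-algebra of the topology of locally uniform convergence. Assume that $v$ has stationary increments: for every $z\in\mathbb R^N$ there is a set $\Omega_z$ of probability $1$ such that, for every $\omega\in\Omega_z$, $$v(x+z,\omega)-v(y+z,\omega)=v(x,\tau_z\omega)-v(y,\tau_z\omega)\qquad\text{for all }x,y\in\mathbb R^N.$$ Then the gradient of $v$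 has a well-defined mean: for every $x\in\mathbb R^N$, $v(\cdot,\omega)$ is differentiable at $x$ for almost every $\omega$, the random vector $Dv(x,\cdot)$ is integrable, and $\mathbb E(Dv(x,\cdot))$ does not depend on $x$. Moreover, this mean is zero if and only if $v$ is almost surely sublinear at infinity, namely $$\lim_{|x|\to+\infty}\frac{v(x,\omega)}{|x|}=0\qquad\text{for almost every }\omega\in\Omega.$$ -/

import Mathlib

open MeasureTheory Filter Topology
open scoped NNReal

/-- An ergodic `N`-dimensional dynamical system `(τ_x)` on the probability space `(Ω, μ)`.
Since `τ x` is a bijection with inverse `τ (-x)` and all conditions are required for every `x`,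
images `τ_x E` may be replaced by preimages under `τ x`. -/
structure IsErgodicDynamicalSystem {N : ℕ} {Ω : Type*} [MeasurableSpace Ω] (μ : Measure Ω)
    (τ : EuclideanSpace ℝ (Fin N) → Ω → Ω) : Prop where
  zero : τ 0 = id
  add : ∀ x y, τ (x + y) = τ x ∘ τ y
  measurePreserving : ∀ x, MeasurePreserving (τ x) μ μ
  measurable_joint : Measurable fun p : EuclideanSpace ℝ (Fin N) × Ω => τ p.1 p.2
  ergodic : ∀ A : Set Ω, MeasurableSet A → (∀ x, μ (symmDiff (τ x ⁻¹' A) A) = 0) →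
    μ A = 0 ∨ μ A = 1

/-- `v` is a Lipschitz random function: for a fixed `κ`, every realization `v ω` is
`κ`-Lipschitz, and `v` is a random variable for the Borel σ-algebra of the topology of
locally uniform convergence (the compact-open topology on `C(ℝ^N, ℝ)`). -/
structure IsLipschitzRandomFunction {N : ℕ} {Ω : Type*} [MeasurableSpace Ω]
    (v : Ω → C(EuclideanSpace ℝ (Fin N), ℝ)) : Prop where
  measurable : @Measurable Ω C(EuclideanSpace ℝ (Fin N), ℝ) _ (borel _) v
  lipschitz : ∃ κ : ℝ≥0, ∀ ω, LipschitzWith κ (v ω)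

/-- `v` has stationary increments with respect to `τ`. -/
def HasStationaryIncrements {N : ℕ} {Ω : Type*} [MeasurableSpace Ω] (μ : Measure Ω)
    (τ : EuclideanSpace ℝ (Fin N) → Ω → Ω) (v : Ω → C(EuclideanSpace ℝ (Fin N), ℝ)) : Prop :=
  ∀ z, ∀ᵐ ω ∂μ, ∀ x y, v ω (x + z) - v ω (y + z) = v (τ z ω) x - v (τ z ω) y

/-- The gradient of `v` has mean `m`: at every `x`, the random variable `Dv(x, ·)` is almost
surely defined, integrable, and has expectation `m`. (At points of non-differentiability
`gradient` takes the value `0`; this concerns a null set of `ω` only.) -/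
def HasGradientMean {N : ℕ} {Ω : Type*} [MeasurableSpace Ω] (μ : Measure Ω)
    (v : Ω → C(EuclideanSpace ℝ (Fin N), ℝ)) (m : EuclideanSpace ℝ (Fin N)) : Prop :=
  ∀ x, (∀ᵐ ω ∂μ, DifferentiableAt ℝ (v ω) x) ∧
    Integrable (fun ω => gradient (v ω) x) μ ∧ ∫ ω, gradient (v ω) x ∂μ = m

/-- `v` is almost surely sublinear at infinity. -/
def IsAlmostSurelySublinear {N : ℕ} {Ω : Type*} [MeasurableSpace Ω] (μ : Measure Ω)
    (v : Ω → C(EuclideanSpace ℝ (Fin N), ℝ)) : Prop :=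
  ∀ᵐ ω ∂μ, Tendsto (fun x : EuclideanSpace ℝ (Fin N) => v ω x / ‖x‖)
    (Bornology.cobounded (EuclideanSpace ℝ (Fin N))) (𝓝 0)

/-! Stationarity spreads almost sure differentiability from one point to all, and makes the mean
gradient `m` constant. The map `x ↦ E[v(x) - v(0)]` is additive, so the mean difference quotient is
the same at every scale. Small scales identify it as `⟨m, x⟩`; under sublinearity, large scales
force it to be zero.

Conversely, let `m = 0`. Along a ray, `v(ne) - v(0)` is a Birkhoff sum of a centred increment under
`τ e`. This single map need not be ergodic, so ergodicity of the whole action is used: by the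
Lipschitz bound, growth faster than slope `a > 0` is an event almost invariant under every `τ z`,
hence of probability 0 or 1. Probability 1 would contradict the maximal ergodic inequality
(`measure_fastGrowth_eq_zero`). Countably many dense directions and the Lipschitz bound then give
sublinearity (`LipschitzWith.tendsto_div_norm_of_dense`). -/

/-! ### Maximal ergodic inequality -/

section MaximalErgodic

variable {Ω : Type*}

/-- The maximum of `0` and the first `n` Birkhoff sums. -/
noncomputable def maxBirkhoffSum (T : Ω → Ω) (f : Ω → ℝ) : ℕ → Ω → ℝ
  | 0 => fun _ => 0
  | n + 1 => fun ω => max 0 (f ω + maxBirkhoffSum T f n (T ω))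

theorem maxBirkhoffSum_nonneg (T : Ω → Ω) (f : Ω → ℝ) (n : ℕ) (ω : Ω) :
    0 ≤ maxBirkhoffSum T f n ω := by
  cases n with
  | zero => exact le_rfl
  | succ n => exact le_max_left _ _

theorem maxBirkhoffSum_le_succ (T : Ω → Ω) (f : Ω → ℝ) (n : ℕ) (ω : Ω) :
    maxBirkhoffSum T f n ω ≤ maxBirkhoffSum T f (n + 1) ω := by
  induction n generalizing ω with
  | zero => exact maxBirkhoffSum_nonneg T f _ ω
  | succ n ih => exact max_le_max le_rfl (add_le_add le_rfl (ih (T ω)))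

theorem birkhoffSum_le_maxBirkhoffSum (T : Ω → Ω) (f : Ω → ℝ) (n : ℕ) (ω : Ω) :
    birkhoffSum T f n ω ≤ maxBirkhoffSum T f n ω := by
  induction n generalizing ω with
  | zero => simp [maxBirkhoffSum]
  | succ n ih =>
    rw [birkhoffSum_succ']
    exact (add_le_add le_rfl (ih (T ω))).trans (le_max_right _ _)

variable [MeasurableSpace Ω] {μ : Measure Ω} {T : Ω → Ω} {f : Ω → ℝ}

theorem MeasureTheory.MeasurePreserving.integral_comp_of_aestronglyMeasurable {G : Type*}
    [NormedAddCommGroup G] [NormedSpace ℝ G] {g : Ω → G} (hT : MeasurePreserving T μ μ)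
    (hg : AEStronglyMeasurable g μ) : ∫ ω, g (T ω) ∂μ = ∫ ω, g ω ∂μ := by
  have h := integral_map (μ := μ) (φ := T) (f := g) hT.measurable.aemeasurable
    (by rwa [hT.map_eq])
  rw [← h, hT.map_eq]

theorem integrable_maxBirkhoffSum (hT : MeasurePreserving T μ μ) (hf : Integrable f μ) (n : ℕ) :
    Integrable (maxBirkhoffSum T f n) μ := by
  induction n with
  | zero => exact integrable_zero _ _ _
  | succ n ih =>
    exact (integrable_zero _ _ _).sup (hf.add (hT.integrable_comp_of_integrable ih))

theorem measurable_maxBirkhoffSum (hT : Measurable T) (hf : Measurable f) (n : ℕ) :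
    Measurable (maxBirkhoffSum T f n) := by
  induction n with
  | zero => exact measurable_const
  | succ n ih => exact measurable_const.max (hf.add (ih.comp hT))

/-- The maximal ergodic inequality. -/
theorem setIntegral_maxBirkhoffSum_pos_nonneg (hT : MeasurePreserving T μ μ)
    (hfm : Measurable f) (hf : Integrable f μ) (n : ℕ) :
    0 ≤ ∫ ω in {ω | 0 < maxBirkhoffSum T f n ω}, f ω ∂μ := by
  set M := maxBirkhoffSum T f n with hM
  have hMm : Measurable M := measurable_maxBirkhoffSum hT.measurable hfm n
  have hMi : Integrable M μ := integrable_maxBirkhoffSum hT hf n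
  have hMTi : Integrable (fun ω => M (T ω)) μ := hT.integrable_comp_of_integrable hMi
  have hA : MeasurableSet {ω | 0 < M ω} := measurableSet_lt measurable_const hMm
  -- Garsia's argument: where `M_n > 0`, the maximum is attained by `f + M_{n-1} ∘ T`, which is at
  -- most `f + M_n ∘ T`.
  have hle : ∫ ω in {ω | 0 < M ω}, (M ω - M (T ω)) ∂μ ≤ ∫ ω in {ω | 0 < M ω}, f ω ∂μ := by
    refine setIntegral_mono_on (hMi.sub hMTi).integrableOn hf.integrableOn hA fun ω hω => ?_
    change 0 < M ω at hω
    rw [hM] at hω ⊢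
    cases n with
    | zero => exact absurd hω (lt_irrefl _)
    | succ k =>
      have h1 : maxBirkhoffSum T f (k + 1) ω = max 0 (f ω + maxBirkhoffSum T f k (T ω)) := rfl
      have h2 := maxBirkhoffSum_le_succ T f k (T ω)
      rcases max_cases 0 (f ω + maxBirkhoffSum T f k (T ω)) with h | h <;> linarith
  refine le_trans ?_ hle
  -- `M` vanishes off the set, so its integral there is the full one, equal by invariance to that of
  -- `M ∘ T ≥ 0`.
  rw [integral_sub hMi.integrableOn hMTi.integrableOn,
    setIntegral_eq_integral_of_forall_compl_eq_zero (s := {ω | 0 < M ω}) (fun ω hω =>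
      le_antisymm (not_lt.1 hω) (maxBirkhoffSum_nonneg T f n ω)),
    ← hT.integral_comp_of_aestronglyMeasurable hMi.aestronglyMeasurable, sub_nonneg]
  exact setIntegral_le_integral hMTi
    (Eventually.of_forall fun ω => maxBirkhoffSum_nonneg T f n (T ω))

/-- The sets where `M_n > 0` increase to a set of full measure, so the maximal inequality passes to
the limit. -/
theorem integral_nonneg_of_ae_exists_birkhoffSum_pos (hT : MeasurePreserving T μ μ)
    (hfm : Measurable f) (hf : Integrable f μ) (h : ∀ᵐ ω ∂μ, ∃ n, 0 < birkhoffSum T f n ω) :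
    0 ≤ ∫ ω, f ω ∂μ := by
  have hlim := tendsto_setIntegral_of_monotone (μ := μ) (f := f)
    (s := fun n => {ω | 0 < maxBirkhoffSum T f n ω})
    (fun n => measurableSet_lt measurable_const (measurable_maxBirkhoffSum hT.measurable hfm n))
    (monotone_nat_of_le_succ fun n ω (hω : 0 < _) => hω.trans_le (maxBirkhoffSum_le_succ T f n ω))
    hf.integrableOn
  rw [Measure.restrict_eq_self_of_ae_mem] at hlim
  · exact ge_of_tendsto' hlim fun n => setIntegral_maxBirkhoffSum_pos_nonneg hT hfm hf n
  · filter_upwards [h] with ω ⟨n, hn⟩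
    exact Set.mem_iUnion.2 ⟨n, hn.trans_le (birkhoffSum_le_maxBirkhoffSum T f n ω)⟩

end MaximalErgodic

/-! ### Gradients and mean increments of random functions -/

section RandomFunction

variable {N : ℕ} {Ω : Type*} [MeasurableSpace Ω] {μ : Measure Ω}
  {τ : EuclideanSpace ℝ (Fin N) → Ω → Ω} {v : Ω → C(EuclideanSpace ℝ (Fin N), ℝ)}

theorem IsLipschitzRandomFunction.measurable_apply (hv : IsLipschitzRandomFunction v)
    (x : EuclideanSpace ℝ (Fin N)) : Measurable fun ω => v ω x := by
  borelize C(EuclideanSpace ℝ (Fin N), ℝ)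
  exact (continuous_eval_const x).measurable.comp hv.measurable

theorem IsLipschitzRandomFunction.measurableSet_differentiableAt
    (hv : IsLipschitzRandomFunction v) :
    MeasurableSet {p : EuclideanSpace ℝ (Fin N) × Ω | DifferentiableAt ℝ (v p.2) p.1} := by
  borelize C(EuclideanSpace ℝ (Fin N), ℝ)
  have h := measurableSet_of_differentiableAt_with_param ℝ
    (f := fun (u : C(EuclideanSpace ℝ (Fin N), ℝ)) x => u x) (by fun_prop)
  exact ((hv.measurable.comp measurable_snd).prodMk measurable_fst) h

theorem IsLipschitzRandomFunction.measurable_gradient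
    (hv : IsLipschitzRandomFunction v) (x : EuclideanSpace ℝ (Fin N)) :
    Measurable fun ω => gradient (v ω) x := by
  borelize C(EuclideanSpace ℝ (Fin N), ℝ)
  have h := measurable_fderiv_with_param ℝ
    (f := fun (u : C(EuclideanSpace ℝ (Fin N), ℝ)) x => u x) (by fun_prop)
  exact (InnerProductSpace.toDual ℝ (EuclideanSpace ℝ (Fin N))).symm.continuous.measurable.comp
    (h.comp (hv.measurable.prodMk measurable_const))

theorem IsLipschitzRandomFunction.neg (hv : IsLipschitzRandomFunction v) :
    IsLipschitzRandomFunction fun ω => -v ω := by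
  borelize C(EuclideanSpace ℝ (Fin N), ℝ)
  obtain ⟨κ, hκ⟩ := hv.lipschitz
  exact ⟨continuous_neg.measurable.comp hv.measurable, κ, fun ω => (hκ ω).neg⟩

theorem HasStationaryIncrements.neg (hinc : HasStationaryIncrements μ τ v) :
    HasStationaryIncrements μ τ fun ω => -v ω := fun z => by
  filter_upwards [hinc z] with ω hω x y
  have := hω x y
  simp only [ContinuousMap.neg_apply]
  linarith

/-- Shifting `ω` translates the realization up to an additive constant, which derivatives do not
see. -/
theorem HasStationaryIncrements.ae_exists_const (hinc : HasStationaryIncrements μ τ v)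
    (z : EuclideanSpace ℝ (Fin N)) :
    ∀ᵐ ω ∂μ, ∃ c : ℝ, ⇑(v (τ z ω)) = fun x => v ω (x + z) + c := by
  filter_upwards [hinc z] with ω hω
  refine ⟨v (τ z ω) 0 - v ω (0 + z), funext fun x => ?_⟩
  have := hω x 0
  linarith

theorem HasStationaryIncrements.ae_differentiableAt_iff (hinc : HasStationaryIncrements μ τ v)
    (x z : EuclideanSpace ℝ (Fin N)) :
    ∀ᵐ ω ∂μ, DifferentiableAt ℝ (v (τ z ω)) x ↔ DifferentiableAt ℝ (v ω) (x + z) := by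
  filter_upwards [hinc.ae_exists_const z] with ω ⟨c, hc⟩
  rw [hc, differentiableAt_add_const_iff, differentiableAt_comp_add_right]

theorem HasStationaryIncrements.ae_gradient_eq (hinc : HasStationaryIncrements μ τ v)
    (x z : EuclideanSpace ℝ (Fin N)) :
    ∀ᵐ ω ∂μ, gradient (v (τ z ω)) x = gradient (v ω) (x + z) := by
  filter_upwards [hinc.ae_exists_const z] with ω ⟨c, hc⟩
  rw [gradient, gradient, hc, fderiv_add_const, fderiv_comp_add_right]

/-- Rademacher's theorem for each `ω` and Fubini give one point `y` of almost sure
differentiability; stationarity carries it to `x`. -/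
theorem ae_differentiableAt_of_hasStationaryIncrements [SFinite μ]
    (hτ : ∀ z, MeasurePreserving (τ z) μ μ) (hv : IsLipschitzRandomFunction v)
    (hinc : HasStationaryIncrements μ τ v) (x : EuclideanSpace ℝ (Fin N)) :
    ∀ᵐ ω ∂μ, DifferentiableAt ℝ (v ω) x := by
  obtain ⟨κ, hκ⟩ := hv.lipschitz
  have h1 : ∀ᵐ y : EuclideanSpace ℝ (Fin N), ∀ᵐ ω ∂μ, DifferentiableAt ℝ (v ω) y :=
    (Measure.ae_ae_comm hv.measurableSet_differentiableAt).2
      (Eventually.of_forall fun ω => (hκ ω).ae_differentiableAt)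
  obtain ⟨y, hy⟩ := h1.exists
  filter_upwards [hinc.ae_differentiableAt_iff y (x - y),
    (hτ (x - y)).quasiMeasurePreserving.ae hy] with ω h2 h3
  simpa using h2.1 h3

theorem IsLipschitzRandomFunction.integrable_gradient [IsFiniteMeasure μ]
    (hv : IsLipschitzRandomFunction v) (x : EuclideanSpace ℝ (Fin N)) :
    Integrable (fun ω => gradient (v ω) x) μ := by
  obtain ⟨κ, hκ⟩ := hv.lipschitz
  refine Integrable.of_bound (hv.measurable_gradient x).aestronglyMeasurable κ
    (Eventually.of_forall fun ω => ?_)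
  rw [gradient, LinearIsometryEquiv.norm_map]
  exact norm_fderiv_le_of_lipschitz ℝ (hκ ω)

theorem IsLipschitzRandomFunction.integrable_sub [IsFiniteMeasure μ]
    (hv : IsLipschitzRandomFunction v) (x y : EuclideanSpace ℝ (Fin N)) :
    Integrable (fun ω => v ω x - v ω y) μ := by
  obtain ⟨κ, hκ⟩ := hv.lipschitz
  exact Integrable.of_bound
    ((hv.measurable_apply x).sub (hv.measurable_apply y)).aestronglyMeasurable (κ * ‖x - y‖)
    (Eventually.of_forall fun ω => (hκ ω).norm_sub_le x y)

theorem exists_hasGradientMean [IsFiniteMeasure μ]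
    (hτ : ∀ z, MeasurePreserving (τ z) μ μ) (hv : IsLipschitzRandomFunction v)
    (hinc : HasStationaryIncrements μ τ v) : ∃ m, HasGradientMean μ v m := by
  refine ⟨∫ ω, gradient (v ω) 0 ∂μ, fun x =>
    ⟨ae_differentiableAt_of_hasStationaryIncrements hτ hv hinc x, hv.integrable_gradient x, ?_⟩⟩
  rw [← (hτ x).integral_comp_of_aestronglyMeasurable
    (hv.measurable_gradient 0).aestronglyMeasurable]
  refine integral_congr_ae ?_
  filter_upwards [hinc.ae_gradient_eq 0 x] with ω hω
  rw [hω, zero_add]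

/-- Split at `z`: the increment from `z` to `x + z` is the one from `0` to `x` composed with `τ z`,
which preserves `μ`. -/
theorem integral_sub_add [IsFiniteMeasure μ]
    (hτ : ∀ z, MeasurePreserving (τ z) μ μ) (hv : IsLipschitzRandomFunction v)
    (hinc : HasStationaryIncrements μ τ v) (x z : EuclideanSpace ℝ (Fin N)) :
    ∫ ω, (v ω (x + z) - v ω 0) ∂μ = ∫ ω, (v ω x - v ω 0) ∂μ + ∫ ω, (v ω z - v ω 0) ∂μ := by
  rw [← (hτ z).integral_comp_of_aestronglyMeasurable (hv.integrable_sub x 0).aestronglyMeasurable,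
    ← integral_add (f := fun ω => v (τ z ω) x - v (τ z ω) 0)
      ((hτ z).integrable_comp_of_integrable (hv.integrable_sub x 0)) (hv.integrable_sub z 0)]
  refine integral_congr_ae ?_
  filter_upwards [hinc z] with ω hω
  have := hω x 0
  rw [zero_add] at this
  linarith

theorem integral_sub_nsmul [IsFiniteMeasure μ]
    (hτ : ∀ z, MeasurePreserving (τ z) μ μ) (hv : IsLipschitzRandomFunction v)
    (hinc : HasStationaryIncrements μ τ v) (x : EuclideanSpace ℝ (Fin N)) (n : ℕ) :
    ∫ ω, (v ω (n • x) - v ω 0) ∂μ = n * ∫ ω, (v ω x - v ω 0) ∂μ := by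
  induction n with
  | zero => simp
  | succ n ih => rw [succ_nsmul, integral_sub_add hτ hv hinc, ih]; push_cast; ring

/-- By additivity the expected difference quotient at scale `1/(n+1)` does not depend on `n`;
dominated convergence, with bound `κ‖x‖`, identifies it with the mean directional derivative at `0`.
-/
theorem HasGradientMean.integral_sub_eq_inner [IsFiniteMeasure μ]
    (hτ : ∀ z, MeasurePreserving (τ z) μ μ) (hv : IsLipschitzRandomFunction v)
    (hinc : HasStationaryIncrements μ τ v) {m : EuclideanSpace ℝ (Fin N)}
    (hm : HasGradientMean μ v m) (x : EuclideanSpace ℝ (Fin N)) :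
    ∫ ω, (v ω x - v ω 0) ∂μ = inner ℝ m x := by
  obtain ⟨κ, hκ⟩ := hv.lipschitz
  obtain ⟨hd, hi, hm⟩ := hm 0
  have hlim : Tendsto (fun n : ℕ => ∫ ω, ((n : ℝ) + 1) *
      (v ω (((n : ℝ) + 1)⁻¹ • x) - v ω 0) ∂μ) atTop (𝓝 (∫ ω, inner ℝ x (gradient (v ω) 0) ∂μ)) := by
    refine tendsto_integral_of_dominated_convergence (fun _ => κ * ‖x‖)
      (fun n => ((hv.integrable_sub _ 0).const_mul _).aestronglyMeasurable)
      (integrable_const _) (fun n => Eventually.of_forall fun ω => ?_) ?_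
    · have hn : (0 : ℝ) < (n : ℝ) + 1 := by positivity
      have h := (hκ ω).norm_sub_le (((n : ℝ) + 1)⁻¹ • x) 0
      rw [sub_zero, norm_smul, Real.norm_of_nonneg (inv_nonneg.2 hn.le)] at h
      rw [norm_mul, Real.norm_of_nonneg hn.le]
      calc ((n : ℝ) + 1) * ‖v ω (((n : ℝ) + 1)⁻¹ • x) - v ω 0‖
          ≤ ((n : ℝ) + 1) * (κ * (((n : ℝ) + 1)⁻¹ * ‖x‖)) := by gcongr
        _ = κ * ‖x‖ := by field_simp
    · filter_upwards [hd] with ω hω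
      have h1 := hω.hasFDerivAt.lim_real x
      have h2 := h1.comp (tendsto_natCast_atTop_atTop (R := ℝ) |>.atTop_add
        (tendsto_const_nhds (x := (1 : ℝ))))
      rw [real_inner_comm, inner_gradient_left]
      simpa [Function.comp_def] using h2
  have hconst : ∀ n : ℕ, ∫ ω, ((n : ℝ) + 1) *
      (v ω (((n : ℝ) + 1)⁻¹ • x) - v ω 0) ∂μ = ∫ ω, (v ω x - v ω 0) ∂μ := fun n => by
    have hn : ((n : ℝ) + 1) ≠ 0 := by positivity
    have h := integral_sub_nsmul hτ hv hinc (((n : ℝ) + 1)⁻¹ • x) (n + 1)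
    rw [← Nat.cast_smul_eq_nsmul ℝ, smul_smul] at h
    push_cast at h
    rw [mul_inv_cancel₀ hn, one_smul] at h
    rw [h, integral_const_mul]
  simp only [hconst] at hlim
  rw [tendsto_nhds_unique tendsto_const_nhds hlim, integral_inner hi, hm, real_inner_comm]

end RandomFunction

/-! ### Sublinearity forces zero mean increments -/

section Sublinear

variable {N : ℕ} {Ω : Type*} [MeasurableSpace Ω] {μ : Measure Ω}
  {τ : EuclideanSpace ℝ (Fin N) → Ω → Ω} {v : Ω → C(EuclideanSpace ℝ (Fin N), ℝ)}

theorem tendsto_nsmul_cobounded {e : EuclideanSpace ℝ (Fin N)} (he : e ≠ 0) :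
    Tendsto (fun n : ℕ => n • e) atTop (Bornology.cobounded (EuclideanSpace ℝ (Fin N))) := by
  rw [← tendsto_norm_atTop_iff_cobounded]
  simp only [← Nat.cast_smul_eq_nsmul ℝ, norm_smul, Real.norm_natCast]
  exact tendsto_natCast_atTop_atTop.atTop_mul_const (norm_pos_iff.2 he)

/-- The same scale invariance, now at scale `n + 1 → ∞`, where sublinearity sends the quotients to
zero. -/
theorem IsAlmostSurelySublinear.integral_sub_eq_zero [IsFiniteMeasure μ]
    (hτ : ∀ z, MeasurePreserving (τ z) μ μ) (hv : IsLipschitzRandomFunction v)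
    (hinc : HasStationaryIncrements μ τ v) (hs : IsAlmostSurelySublinear μ v)
    (x : EuclideanSpace ℝ (Fin N)) : ∫ ω, (v ω x - v ω 0) ∂μ = 0 := by
  rcases eq_or_ne x 0 with rfl | hx
  · simp
  obtain ⟨κ, hκ⟩ := hv.lipschitz
  have hlim : Tendsto (fun n : ℕ => ∫ ω, ((n : ℝ) + 1)⁻¹ *
      (v ω ((n + 1) • x) - v ω 0) ∂μ) atTop (𝓝 (∫ _, (0 : ℝ) ∂μ)) := by
    refine tendsto_integral_of_dominated_convergence (fun _ => κ * ‖x‖)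
      (fun n => ((hv.integrable_sub _ 0).const_mul _).aestronglyMeasurable)
      (integrable_const _) (fun n => Eventually.of_forall fun ω => ?_) ?_
    · have hn : (0 : ℝ) < (n : ℝ) + 1 := by positivity
      have h := (hκ ω).norm_sub_le ((n + 1) • x) 0
      rw [sub_zero, ← Nat.cast_smul_eq_nsmul ℝ, norm_smul, Real.norm_natCast] at h
      push_cast at h
      rw [norm_mul, Real.norm_of_nonneg (inv_nonneg.2 hn.le), ← Nat.cast_smul_eq_nsmul ℝ]
      push_cast
      calc ((n : ℝ) + 1)⁻¹ * ‖v ω (((n : ℝ) + 1) • x) - v ω 0‖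
          ≤ ((n : ℝ) + 1)⁻¹ * (κ * (((n : ℝ) + 1) * ‖x‖)) := by gcongr
        _ = κ * ‖x‖ := by field_simp
    · filter_upwards [hs] with ω hω
      have h1 := (((hω.comp (tendsto_nsmul_cobounded hx)).mul_const ‖x‖).sub
        ((tendsto_inv_atTop_zero.comp tendsto_natCast_atTop_atTop).mul_const (v ω 0))).comp
          (tendsto_add_atTop_nat 1)
      simp only [zero_mul, sub_zero] at h1
      refine h1.congr fun n => ?_
      have hx' : ‖x‖ ≠ 0 := norm_ne_zero_iff.2 hx
      have hn : ((n : ℝ) + 1) ≠ 0 := by positivity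
      simp only [Function.comp_def, ← Nat.cast_smul_eq_nsmul ℝ, norm_smul, Real.norm_natCast]
      push_cast
      field_simp
  have hconst : ∀ n : ℕ, ∫ ω, ((n : ℝ) + 1)⁻¹ *
      (v ω ((n + 1) • x) - v ω 0) ∂μ = ∫ ω, (v ω x - v ω 0) ∂μ := fun n => by
    have hn : ((n : ℝ) + 1) ≠ 0 := by positivity
    rw [integral_const_mul, integral_sub_nsmul hτ hv hinc]
    push_cast
    field_simp
  simp only [hconst, integral_zero] at hlim
  exact tendsto_nhds_unique tendsto_const_nhds hlim

/-! ### Growth along a single ray -/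

theorem IsErgodicDynamicalSystem.iterate_eq (hτ : IsErgodicDynamicalSystem μ τ)
    (e : EuclideanSpace ℝ (Fin N)) (n : ℕ) : (τ e)^[n] = τ (n • e) := by
  induction n with
  | zero => simp [hτ.zero]
  | succ n ih => rw [Function.iterate_succ, ih, succ_nsmul, hτ.add]

/-- The sum telescopes: the increment from `ne` to `(n+1)e` is the first increment evaluated at `τ
(n • e) ω`. -/
theorem ae_birkhoffSum_eq (hτ : IsErgodicDynamicalSystem μ τ)
    (hinc : HasStationaryIncrements μ τ v) (e : EuclideanSpace ℝ (Fin N)) :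
    ∀ᵐ ω ∂μ, ∀ n : ℕ, birkhoffSum (τ e) (fun ω => v ω e - v ω 0) n ω = v ω (n • e) - v ω 0 := by
  filter_upwards [ae_all_iff.2 fun n : ℕ => hinc (n • e)] with ω hω n
  induction n with
  | zero => simp
  | succ n ih =>
    have := hω n e 0
    rw [zero_add] at this
    rw [birkhoffSum_succ, ih, hτ.iterate_eq, succ_nsmul, add_comm (n • e) e]
    linarith

/-- The event that the increments of `v` in direction `e` grow faster than slope `a`. -/
def fastGrowth (v : Ω → C(EuclideanSpace ℝ (Fin N), ℝ)) (e : EuclideanSpace ℝ (Fin N)) (a : ℝ) :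
    Set Ω :=
  {ω | ∃ k : ℕ, ∃ᶠ n : ℕ in atTop, (a + 1 / ((k : ℝ) + 1)) * n < v ω (n • e) - v ω 0}

theorem measurableSet_fastGrowth (hv : IsLipschitzRandomFunction v)
    (e : EuclideanSpace ℝ (Fin N)) (a : ℝ) : MeasurableSet (fastGrowth v e a) := by
  simp only [fastGrowth, frequently_atTop]
  refine measurableSet_setOfPred.2 (.exists fun k => .forall fun n => .exists fun b =>
    .and measurable_const ?_)
  exact measurableSet_setOfPred.1 (measurableSet_lt measurable_const
    ((hv.measurable_apply _).sub (hv.measurable_apply _)))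

/-- The margin `1/(k+1)` above `a` absorbs bounded perturbations: passing from `k` to `k + 1` frees
a positive slope, which times `n` eventually exceeds `C`. -/
theorem exists_frequently_lt_of_abs_sub_le {s t : ℕ → ℝ} {a C : ℝ} (hst : ∀ n, |s n - t n| ≤ C)
    (h : ∃ k : ℕ, ∃ᶠ n : ℕ in atTop, (a + 1 / ((k : ℝ) + 1)) * n < s n) :
    ∃ k : ℕ, ∃ᶠ n : ℕ in atTop, (a + 1 / ((k : ℝ) + 1)) * n < t n := by
  obtain ⟨k, hk⟩ := h
  refine ⟨k + 1, ?_⟩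
  have hpos : (0 : ℝ) < 1 / ((k : ℝ) + 1) - 1 / ((k : ℝ) + 1 + 1) :=
    sub_pos.2 (one_div_lt_one_div_of_lt (by positivity) (by linarith))
  have hev := (tendsto_natCast_atTop_atTop (R := ℝ)).const_mul_atTop hpos
    |>.eventually_ge_atTop C
  refine (hk.and_eventually hev).mono fun n ⟨h1, h2⟩ => ?_
  have := (abs_le.1 (hst n)).2
  push_cast
  linarith

/-- A shift by any `z` alters both endpoint values by at most `κ‖z‖`, uniformly in `n`. -/
theorem ae_mem_fastGrowth_iff (hv : IsLipschitzRandomFunction v)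
    (hinc : HasStationaryIncrements μ τ v) (e : EuclideanSpace ℝ (Fin N)) (a : ℝ)
    (z : EuclideanSpace ℝ (Fin N)) :
    ∀ᵐ ω ∂μ, τ z ω ∈ fastGrowth v e a ↔ ω ∈ fastGrowth v e a := by
  obtain ⟨κ, hκ⟩ := hv.lipschitz
  filter_upwards [hinc z] with ω hω
  have h : ∀ n : ℕ, |(v (τ z ω) (n • e) - v (τ z ω) 0) - (v ω (n • e) - v ω 0)|
      ≤ 2 * (κ * ‖z‖) := fun n => by
    have h1 := (hκ ω).norm_sub_le (n • e + z) (n • e)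
    have h2 := (hκ ω).norm_sub_le (0 + z) 0
    rw [add_sub_cancel_left, Real.norm_eq_abs, abs_le] at h1
    rw [add_sub_cancel_left, Real.norm_eq_abs, abs_le] at h2
    rw [← hω, abs_le]
    constructor <;> linarith [h1.1, h1.2, h2.1, h2.2]
  exact ⟨exists_frequently_lt_of_abs_sub_le h,
    exists_frequently_lt_of_abs_sub_le fun n => (abs_sub_comm _ _).trans_le (h n)⟩

/-- By ergodicity only probability 1 must be excluded. In that case the centred increment minus `a`
almost surely has a positive Birkhoff sum, so its mean `-a` would be nonnegative. -/
theorem measure_fastGrowth_eq_zero [IsProbabilityMeasure μ] (hτ : IsErgodicDynamicalSystem μ τ)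
    (hv : IsLipschitzRandomFunction v) (hinc : HasStationaryIncrements μ τ v)
    (e : EuclideanSpace ℝ (Fin N)) (he : ∫ ω, (v ω e - v ω 0) ∂μ = 0) {a : ℝ} (ha : 0 < a) :
    μ (fastGrowth v e a) = 0 := by
  have hB := measurableSet_fastGrowth hv e a
  refine (hτ.ergodic _ hB fun z => measure_symmDiff_eq_zero_iff.2
    (eventuallyEq_set.2 (ae_mem_fastGrowth_iff hv hinc e a z))).resolve_right fun h1 => ?_
  have hpos : 0 ≤ ∫ ω, ((v ω e - v ω 0) - a) ∂μ := by
    refine integral_nonneg_of_ae_exists_birkhoffSum_pos (hτ.measurePreserving e)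
      (((hv.measurable_apply e).sub (hv.measurable_apply 0)).sub_const a)
      ((hv.integrable_sub e 0).sub (integrable_const a)) ?_
    filter_upwards [(mem_ae_iff_prob_eq_one hB).2 h1, ae_birkhoffSum_eq hτ hinc e]
      with ω ⟨k, hk⟩ hω
    obtain ⟨n, hn⟩ := hk.exists
    refine ⟨n, ?_⟩
    have h2 := birkhoffSum_sub (τ e) (fun ω => v ω e - v ω 0) (fun _ => a) n ω
    have h3 : birkhoffSum (τ e) (fun _ => a) n ω = n * a := by simp [birkhoffSum]
    have h4 : (0 : ℝ) ≤ 1 / ((k : ℝ) + 1) * n := by positivity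
    rw [h3, hω] at h2
    refine lt_of_lt_of_eq ?_ h2.symm
    linarith
  rw [integral_sub (hv.integrable_sub e 0) (integrable_const a), he] at hpos
  simp at hpos
  linarith

theorem ae_eventually_sub_le [IsProbabilityMeasure μ] (hτ : IsErgodicDynamicalSystem μ τ)
    (hv : IsLipschitzRandomFunction v) (hinc : HasStationaryIncrements μ τ v)
    (e : EuclideanSpace ℝ (Fin N)) (he : ∫ ω, (v ω e - v ω 0) ∂μ = 0) :
    ∀ᵐ ω ∂μ, ∀ ε : ℝ, 0 < ε → ∀ᶠ n : ℕ in atTop, v ω (n • e) - v ω 0 ≤ ε * n := by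
  have h : ∀ k : ℕ, ∀ᵐ ω ∂μ, ω ∉ fastGrowth v e (1 / ((k : ℝ) + 1)) := fun k =>
    measure_eq_zero_iff_ae_notMem.1
      (measure_fastGrowth_eq_zero hτ hv hinc e he (by positivity))
  filter_upwards [ae_all_iff.2 h] with ω hω ε hε
  -- Half of `ε` pays for the slope `1/(k+1)`, the other half for the equal margin in `fastGrowth`.
  obtain ⟨k, hk⟩ := exists_nat_one_div_lt (half_pos hε)
  have h1 := hω k
  simp only [fastGrowth, Set.mem_ofPred_eq, not_exists, not_frequently, not_lt] at h1
  filter_upwards [h1 k] with n hn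
  refine hn.trans ?_
  gcongr
  linarith

/-- The lower bound is the upper bound for `-v`, which satisfies the same hypotheses. -/
theorem ae_eventually_abs_sub_le [IsProbabilityMeasure μ] (hτ : IsErgodicDynamicalSystem μ τ)
    (hv : IsLipschitzRandomFunction v) (hinc : HasStationaryIncrements μ τ v)
    (e : EuclideanSpace ℝ (Fin N)) (he : ∫ ω, (v ω e - v ω 0) ∂μ = 0) :
    ∀ᵐ ω ∂μ, ∀ ε : ℝ, 0 < ε → ∀ᶠ n : ℕ in atTop, |v ω (n • e) - v ω 0| ≤ ε * n := by
  have he' : ∫ ω, ((-v ω) e - (-v ω) 0) ∂μ = 0 := by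
    rw [← neg_eq_zero, ← integral_neg, ← he]
    refine integral_congr_ae (Eventually.of_forall fun ω => ?_)
    simp only [ContinuousMap.neg_apply]
    ring
  filter_upwards [ae_eventually_sub_le hτ hv hinc e he,
    ae_eventually_sub_le hτ hv.neg hinc.neg e he'] with ω h1 h2 ε hε
  filter_upwards [h1 ε hε, h2 ε hε] with n h3 h4
  simp only [ContinuousMap.neg_apply] at h4
  exact abs_le.2 ⟨by linarith, h3⟩

/-! ### From a dense set of rays to all directions -/

/-- A Lipschitz function which is sublinear along a dense set of rays is sublinear. -/
theorem LipschitzWith.tendsto_div_norm_of_dense {u : EuclideanSpace ℝ (Fin N) → ℝ} {κ : ℝ≥0}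
    (hu : LipschitzWith κ u) {D : Set (EuclideanSpace ℝ (Fin N))} (hD : Dense D)
    (h : ∀ e ∈ D, ∀ ε : ℝ, 0 < ε → ∀ᶠ n : ℕ in atTop, |u (n • e) - u 0| ≤ ε * n) :
    Tendsto (fun x => u x / ‖x‖) (Bornology.cobounded (EuclideanSpace ℝ (Fin N))) (𝓝 0) := by
  refine Metric.tendsto_nhds.2 fun ε hε => ?_
  -- The `1` keeps the net points in norm at most `2`; `κ + 1` avoids dividing by zero and gives `κδ
  -- ≤ ε/4`.
  set δ : ℝ := min 1 (ε / (4 * (κ + 1))) with hδ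
  have hκ : (0 : ℝ) ≤ κ := κ.coe_nonneg
  have hδ0 : 0 < δ := lt_min one_pos (by positivity)
  have hκδ : κ * δ ≤ ε / 4 := by
    have h1 : (κ + 1) * δ ≤ (κ + 1) * (ε / (4 * (κ + 1))) := by
      gcongr
      exact min_le_right _ _
    have h2 : ((κ : ℝ) + 1) * (ε / (4 * (κ + 1))) = ε / 4 := by field_simp
    linarith
  -- A finite net of directions makes the threshold in `n` uniform over them.
  obtain ⟨s, hsD, hsf, hs⟩ := (isCompact_sphere (0 : EuclideanSpace ℝ (Fin N)) 1)
    |>.elim_finite_subcover_image (b := D) (c := fun e => Metric.ball e δ)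
      (fun _ _ => Metric.isOpen_ball) (fun x _ => by
        obtain ⟨y, hy, hxy⟩ := hD.exists_dist_lt x hδ0
        exact Set.mem_biUnion hy hxy)
  have hev : ∀ᶠ n : ℕ in atTop, ∀ e ∈ s, |u (n • e) - u 0| ≤ ε / 4 * n :=
    (eventually_all_finite hsf).2 fun e he => h e (hsD he) _ (by positivity)
  have hfloor : Tendsto (fun x : EuclideanSpace ℝ (Fin N) => ⌊‖x‖⌋₊)
      (Bornology.cobounded _) atTop :=
    tendsto_nat_floor_atTop.comp tendsto_norm_cobounded_atTop
  filter_upwards [hfloor.eventually hev,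
    tendsto_norm_cobounded_atTop.eventually_gt_atTop (4 * (|u 0| + 2 * κ) / ε),
    tendsto_norm_cobounded_atTop.eventually_gt_atTop 0] with x hx1 hx2 hx0
  obtain ⟨e, hes, hxe⟩ := Set.mem_iUnion₂.1 (hs (show ‖x‖⁻¹ • x ∈ Metric.sphere 0 1 by
    rw [mem_sphere_zero_iff_norm, norm_smul, norm_inv, norm_norm, inv_mul_cancel₀ hx0.ne']))
  have hn1 : (⌊‖x‖⌋₊ : ℝ) ≤ ‖x‖ := Nat.floor_le hx0.le
  have hn2 : ‖x‖ < (⌊‖x‖⌋₊ : ℝ) + 1 := Nat.lt_floor_add_one _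
  have hd1 : ‖‖x‖⁻¹ • x - e‖ < δ := by rwa [← dist_eq_norm]
  have he2 : ‖e‖ ≤ 2 := by
    have h1 : ‖‖x‖⁻¹ • x‖ = 1 := by
      rw [norm_smul, norm_inv, norm_norm, inv_mul_cancel₀ hx0.ne']
    have h2 := norm_sub_norm_le e (‖x‖⁻¹ • x)
    rw [norm_sub_rev] at h2
    linarith [min_le_left 1 (ε / (4 * ((κ : ℝ) + 1)))]
  -- The direction error costs `‖x‖δ`; rounding `‖x‖` down costs at most `‖e‖ ≤ 2`.
  have hd2 : ‖x - ⌊‖x‖⌋₊ • e‖ ≤ ‖x‖ * δ + 2 := by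
    have h1 : x - ⌊‖x‖⌋₊ • e = ‖x‖ • (‖x‖⁻¹ • x - e) + (‖x‖ - ⌊‖x‖⌋₊) • e := by
      rw [smul_sub, smul_smul, mul_inv_cancel₀ hx0.ne', one_smul, sub_smul,
        Nat.cast_smul_eq_nsmul]
      abel
    rw [h1]
    refine (norm_add_le _ _).trans (add_le_add ?_ ?_)
    · rw [norm_smul, norm_norm]
      gcongr
    · rw [norm_smul, Real.norm_of_nonneg (by linarith)]
      nlinarith [norm_nonneg e]
  have hL := hu.norm_sub_le x (⌊‖x‖⌋₊ • e)
  have hL2 : (κ : ℝ) * ‖x - ⌊‖x‖⌋₊ • e‖ ≤ ε / 4 * ‖x‖ + 2 * κ := by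
    calc (κ : ℝ) * ‖x - ⌊‖x‖⌋₊ • e‖ ≤ κ * (‖x‖ * δ + 2) := by gcongr
      _ = κ * δ * ‖x‖ + 2 * κ := by ring
      _ ≤ _ := by gcongr
  have hS := hx1 e hes
  have hS2 : ε / 4 * (⌊‖x‖⌋₊ : ℝ) ≤ ε / 4 * ‖x‖ := by gcongr
  have hx3 : |u 0| + 2 * κ < ε / 4 * ‖x‖ := by
    rw [div_lt_iff₀ hε] at hx2
    linarith
  rw [dist_zero_right, norm_div, norm_norm, div_lt_iff₀ hx0, Real.norm_eq_abs]
  rw [Real.norm_eq_abs] at hL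
  have htri : |u x| ≤ |u x - u (⌊‖x‖⌋₊ • e)| + |u (⌊‖x‖⌋₊ • e) - u 0| + |u 0| := by
    have h1 := abs_add_le (u x - u (⌊‖x‖⌋₊ • e) + (u (⌊‖x‖⌋₊ • e) - u 0)) (u 0)
    have h2 := abs_add_le (u x - u (⌊‖x‖⌋₊ • e)) (u (⌊‖x‖⌋₊ • e) - u 0)
    rw [show u x - u (⌊‖x‖⌋₊ • e) + (u (⌊‖x‖⌋₊ • e) - u 0) + u 0 = u x by ring] at h1
    linarith
  -- The Lipschitz error, the growth along the ray and the constants contribute at most `ε‖x‖/4`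
  -- each.
  nlinarith [mul_pos hε hx0]

/-- Countability of the dense set of directions lets a single null set serve them all. -/
theorem isAlmostSurelySublinear_of_integral_sub_eq_zero [IsProbabilityMeasure μ]
    (hτ : IsErgodicDynamicalSystem μ τ) (hv : IsLipschitzRandomFunction v)
    (hinc : HasStationaryIncrements μ τ v) (h : ∀ e, ∫ ω, (v ω e - v ω 0) ∂μ = 0) :
    IsAlmostSurelySublinear μ v := by
  obtain ⟨κ, hκ⟩ := hv.lipschitz
  obtain ⟨D, hDc, hD⟩ := TopologicalSpace.exists_countable_dense (EuclideanSpace ℝ (Fin N))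
  filter_upwards [(ae_ball_iff hDc).2 fun e _ => ae_eventually_abs_sub_le hτ hv hinc e (h e)]
    with ω hω
  exact (hκ ω).tendsto_div_norm_of_dense hD hω

end Sublinear

theorem mainTheorem11 {N : ℕ} {Ω : Type*} [MeasurableSpace Ω] (μ : Measure Ω)
    [IsProbabilityMeasure μ] (τ : EuclideanSpace ℝ (Fin N) → Ω → Ω)
    (hτ : IsErgodicDynamicalSystem μ τ)
    (v : Ω → C(EuclideanSpace ℝ (Fin N), ℝ)) (hv : IsLipschitzRandomFunction v)
    (hinc : HasStationaryIncrements μ τ v) :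
    (∃ m, HasGradientMean μ v m) ∧
      (HasGradientMean μ v 0 ↔ IsAlmostSurelySublinear μ v) := by
  have hmp := hτ.measurePreserving
  obtain ⟨m, hm⟩ := exists_hasGradientMean hmp hv hinc
  refine ⟨⟨m, hm⟩, fun h0 => ?_, fun hs => ?_⟩
  · refine isAlmostSurelySublinear_of_integral_sub_eq_zero hτ hv hinc fun e => ?_
    rw [h0.integral_sub_eq_inner hmp hv hinc, inner_zero_left]
  -- Testing the mean increment at `x = m` gives `⟨m, m⟩ = 0`.
  · have hm0 : m = 0 := by
      rw [← inner_self_eq_zero (𝕜 := ℝ), ← hm.integral_sub_eq_inner hmp hv hinc,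
        hs.integral_sub_eq_zero hmp hv hinc]
    exact hm0 ▸ hm
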